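/- A loop $(G,\circ,e)$ is a set $G$ with a binary operation $\circ$ such that for all $a,b\in G$ there are a unique $x\in G$ with $a\circ x=b$ (written $x=a\backslash b$) and a unique $y\in G$ with $y\circ a=b$ (written $y=b/a$), and with an element $e\in G$ such that $a\circ e=a=e\circ a$ for all $a\in G$. A loop on $\mathbb{R}$ is smooth if the maps $(a,b)\mapsto a\circ b$, $(a,b)\mapsto a\backslash b$ and $(b,a)\mapsto b/a$ from $\mathbb{R}^2$ to $\mathbb{R}$ are infinitely differentiable. An invariant right measure on a loop on $\mathbb{R}$ is a nonzero $\sigma$-finite Borel measure $\mu$ on $\mathbb{R}$ such that, for every $v\in\mathbb{R}$, the image of $\mu$ under the right translation $\theta\mapsto\theta\circ v$ equals $\mu$. Theorem. There exists a smooth loop on the real line that admits no invariant right measure. -/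

import Mathlib

/-!
Let `s` be a smooth monotone function which is `0` on `(-∞, 0]` and `1` on `[1, ∞)`, and let
`a ∘ b = a + b + s a * s b`. Translations are strictly increasing with positive derivative and stay
at bounded distance from ordinary translations, so this is a loop, and it is smooth by the implicit
function theorem. Since `θ ∘ v = θ + v` for `v ≤ 0`, an invariant right measure is invariant under
all ordinary translations, and by uniqueness of Haar measure every right translation of the loop
preserves Lebesgue measure. But `θ ↦ θ ∘ 1` maps `[0, 1]` onto `[1, 3]`.
-/

open scoped ContDiff

/-- An algebraic loop on `G`: a set with a binary operation such that, for all `a` and `b`, the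
equations `a ∘ x = b` and `y ∘ a = b` have unique solutions, and with a two-sided identity. -/
structure AlgLoop (G : Type*) where
  /-- The binary operation `a ∘ b`. -/
  op : G → G → G
  /-- The identity element. -/
  e : G
  existsUnique_left : ∀ a b : G, ∃! x : G, op a x = b
  existsUnique_right : ∀ a b : G, ∃! y : G, op y a = b
  op_e : ∀ a : G, op a e = a
  e_op : ∀ a : G, op e a = a

namespace AlgLoop

/-- Left division `a \ b`: the unique `x` with `a ∘ x = b`. -/
noncomputable def ldiv {G : Type*} (L : AlgLoop G) (a b : G) : G :=
  (L.existsUnique_left a b).choose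

/-- Right division `b / a`: the unique `y` with `y ∘ a = b`. -/
noncomputable def rdiv {G : Type*} (L : AlgLoop G) (b a : G) : G :=
  (L.existsUnique_right a b).choose

/-- A smooth loop on a real normed space: the operation and both divisions are infinitely
differentiable, jointly in their two arguments. -/
structure IsSmooth {G : Type*} [NormedAddCommGroup G] [NormedSpace ℝ G] (L : AlgLoop G) :
    Prop where
  contDiff_op : ContDiff ℝ ∞ (fun p : G × G => L.op p.1 p.2)
  contDiff_ldiv : ContDiff ℝ ∞ (fun p : G × G => L.ldiv p.1 p.2)
  contDiff_rdiv : ContDiff ℝ ∞ (fun p : G × G => L.rdiv p.1 p.2)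

/-- An invariant right measure on a loop: a nonzero `σ`-finite measure which is invariant under
every right translation `θ ↦ θ ∘ v`. -/
structure IsInvariantRightMeasure {G : Type*} [MeasurableSpace G] (L : AlgLoop G)
    (μ : MeasureTheory.Measure G) : Prop where
  ne_zero : μ ≠ 0
  sigmaFinite : MeasureTheory.SigmaFinite μ
  measurePreserving : ∀ v : G, MeasureTheory.MeasurePreserving (fun θ => L.op θ v) μ μ

end AlgLoop

open MeasureTheory Set Filter Function

section ImplicitFunction

variable {𝕜 E₁ E₂ F : Type*} [RCLike 𝕜]
  [NormedAddCommGroup E₁] [NormedSpace 𝕜 E₁] [CompleteSpace E₁]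
  [NormedAddCommGroup E₂] [NormedSpace 𝕜 E₂] [CompleteSpace E₂]
  [NormedAddCommGroup F] [NormedSpace 𝕜 F] [CompleteSpace F]

theorem contDiff_of_forall_apply_eq_iff {n : ℕ∞ω} {f : E₁ × E₂ → F} {g : E₁ → E₂} {c : F}
    (hf : ContDiff 𝕜 n f) (hn : n ≠ 0)
    (hf' : ∀ x, (fderiv 𝕜 (fun y => f (x, y)) (g x)).IsInvertible)
    (hfg : ∀ x y, f (x, y) = c ↔ y = g x) : ContDiff 𝕜 n g := by
  refine contDiff_iff_contDiffAt.2 fun x => ?_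
  have hfx : ContDiffAt 𝕜 n f (x, g x) := hf.contDiffAt
  have hpartial : fderiv 𝕜 (fun y => f (x, y)) (g x) = fderiv 𝕜 f (x, g x) ∘L .inr 𝕜 E₁ E₂ :=
    ((hfx.differentiableAt hn).hasFDerivAt.comp (g x) (hasFDerivAt_prodMk_right x (g x))).fderiv
  have hinv := hpartial ▸ hf' x
  refine (hfx.contDiffAt_implicitFunction hn hinv).congr_of_eventuallyEq ?_
  filter_upwards [hfx.eventually_apply_implicitFunction hn hinv] with x' hx'
  exact ((hfg x' _).1 (hx'.trans ((hfg x (g x)).2 rfl))).symm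

end ImplicitFunction

theorem isInvertible_fderiv_of_deriv_ne_zero {𝕜 : Type*} [NontriviallyNormedField 𝕜] {f : 𝕜 → 𝕜}
    {x : 𝕜} (hf : deriv f x ≠ 0) : (fderiv 𝕜 f x).IsInvertible :=
  ⟨_, ((differentiableAt_of_deriv_ne_zero hf).hasDerivAt.hasFDerivAt_equiv hf).fderiv.symm⟩

theorem surjective_of_continuous_of_add_le_of_le_add {f : ℝ → ℝ} {a b : ℝ} (hf : Continuous f)
    (ha : ∀ x, a + x ≤ f x) (hb : ∀ x, f x ≤ b + x) : Surjective f :=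
  hf.surjective (tendsto_atTop_mono ha (tendsto_atTop_add_const_left _ a tendsto_id))
    (tendsto_atBot_mono hb (tendsto_atBot_add_const_left _ b tendsto_id))

theorem sub_eq_sub_of_measurePreserving_volume {f : ℝ → ℝ} (hf : StrictMono f)
    (hvol : MeasurePreserving f) {a b : ℝ} (hab : a ≤ b) : f b - f a = b - a := by
  have hpre : f ⁻¹' Icc (f a) (f b) = Icc a b := by
    ext x
    simp only [mem_preimage, mem_Icc, hf.le_iff_le]
  have hlength := hvol.measure_preimage (measurableSet_Icc (a := f a) (b := f b)).nullMeasurableSet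
  rw [hpre, Real.volume_Icc, Real.volume_Icc, ENNReal.ofReal_eq_ofReal_iff (sub_nonneg.2 hab)
    (sub_nonneg.2 (hf.monotone hab))] at hlength
  exact hlength.symm

theorem isAddLeftInvariant_of_forall_nonpos {G : Type*} [AddGroup G] [LinearOrder G]
    [AddLeftMono G] [MeasurableSpace G] [MeasurableAdd G] {μ : Measure G}
    (hμ : ∀ v ≤ 0, MeasurePreserving (v + ·) μ μ) : μ.IsAddLeftInvariant := by
  refine ⟨fun v => ?_⟩
  rcases le_total v 0 with hv | hv
  · exact (hμ v hv).map_eq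
  · simpa using (MeasurePreserving.symm (MeasurableEquiv.addLeft (-v))
      (hμ (-v) (neg_nonpos.2 hv))).map_eq

theorem exists_eq_smul_of_isAddLeftInvariant {G : Type*} [AddGroup G] [MeasurableSpace G]
    [MeasurableAdd₂ G] [MeasurableNeg G] (μ ν : Measure G) [SigmaFinite μ] [SigmaFinite ν]
    [μ.IsAddLeftInvariant] [ν.IsAddLeftInvariant] (hμ : μ ≠ 0) : ∃ c : ENNReal, ν = c • μ := by
  obtain ⟨s, -, -, hs_pos, hs_top⟩ := Measure.exists_subset_measure_lt_top (μ := μ)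
    MeasurableSet.univ (Measure.measure_univ_pos.2 hμ)
  exact ⟨_, measure_eq_sub_vadd ν μ hs_pos.ne' hs_top.ne⟩

namespace AlgLoop

variable {G : Type*}

theorem op_eq_iff_eq_ldiv (L : AlgLoop G) {a b x : G} : L.op a x = b ↔ x = L.ldiv a b := by
  have hspec := (L.existsUnique_left a b).choose_spec
  exact ⟨hspec.2 x, fun h => h ▸ hspec.1⟩

theorem op_eq_iff_eq_rdiv (L : AlgLoop G) {a b y : G} : L.op y a = b ↔ y = L.rdiv b a := by
  have hspec := (L.existsUnique_right a b).choose_spec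
  exact ⟨hspec.2 y, fun h => h ▸ hspec.1⟩

theorem isSmooth_of_contDiff_op [NormedAddCommGroup G] [NormedSpace ℝ G] [CompleteSpace G]
    {L : AlgLoop G} (hop : ContDiff ℝ ∞ fun p : G × G => L.op p.1 p.2)
    (hleft : ∀ a x, (fderiv ℝ (L.op a) x).IsInvertible)
    (hright : ∀ a y, (fderiv ℝ (L.op · a) y).IsInvertible) : L.IsSmooth where
  contDiff_op := hop
  contDiff_ldiv := by
    refine contDiff_of_forall_apply_eq_iff (f := fun u => L.op u.1.1 u.2 - u.1.2) (c := 0)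
      ?_ (by simp) (fun p => ?_) fun p x => sub_eq_zero.trans L.op_eq_iff_eq_ldiv
    · exact (hop.comp (contDiff_fst.fst.prodMk contDiff_snd)).sub contDiff_fst.snd
    · simpa only [fderiv_sub_const] using hleft p.1 _
  contDiff_rdiv := by
    refine contDiff_of_forall_apply_eq_iff (f := fun u => L.op u.2 u.1.2 - u.1.1) (c := 0)
      ?_ (by simp) (fun p => ?_) fun p y => sub_eq_zero.trans L.op_eq_iff_eq_rdiv
    · exact (hop.comp (contDiff_snd.prodMk contDiff_fst.snd)).sub contDiff_fst.fst
    · simpa only [fderiv_sub_const] using hright p.2 _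

theorem IsInvariantRightMeasure.measurePreserving_of_op_eq_add [AddCommGroup G] [LinearOrder G]
    [AddLeftMono G] [MeasurableSpace G] [MeasurableAdd₂ G] [MeasurableNeg G]
    {L : AlgLoop G} {μ : Measure G} (hμ : L.IsInvariantRightMeasure μ)
    (hop : ∀ v ≤ 0, ∀ θ, L.op θ v = θ + v) (ν : Measure G) [SigmaFinite ν] [ν.IsAddLeftInvariant]
    (v : G) : MeasurePreserving (L.op · v) ν ν := by
  have := hμ.sigmaFinite
  have : μ.IsAddLeftInvariant := isAddLeftInvariant_of_forall_nonpos fun v hv => by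
    simpa only [hop v hv, add_comm _ v] using hμ.measurePreserving v
  obtain ⟨c, rfl⟩ := exists_eq_smul_of_isAddLeftInvariant μ ν hμ.ne_zero
  exact (hμ.measurePreserving v).smul_measure c

end AlgLoop

/-- Addition on `ℝ` deformed by a term that vanishes unless both arguments are positive: the
operation of `transitionLoop`. -/
noncomputable def transitionAdd (a b : ℝ) : ℝ :=
  a + b + Real.smoothTransition a * Real.smoothTransition b

namespace transitionAdd

open Real (smoothTransition)

theorem comm (a b : ℝ) : transitionAdd a b = transitionAdd b a := by
  rw [transitionAdd, transitionAdd, add_comm a, mul_comm]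

theorem of_nonpos_right (a : ℝ) {b : ℝ} (hb : b ≤ 0) : transitionAdd a b = a + b := by
  rw [transitionAdd, smoothTransition.zero_of_nonpos hb, mul_zero, add_zero]

theorem zero_right (a : ℝ) : transitionAdd a 0 = a := by
  rw [of_nonpos_right a le_rfl, add_zero]

theorem add_le (a b : ℝ) : a + b ≤ transitionAdd a b :=
  le_add_of_nonneg_right (mul_nonneg (smoothTransition.nonneg a) (smoothTransition.nonneg b))

theorem le_add (a b : ℝ) : transitionAdd a b ≤ a + 1 + b := by
  have := mul_le_one₀ (smoothTransition.le_one a) (smoothTransition.nonneg b)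
    (smoothTransition.le_one b)
  rw [transitionAdd]
  linarith

theorem strictMono_right (a : ℝ) : StrictMono (transitionAdd a) :=
  (add_right_strictMono (a := a)).add_monotone
    (smoothTransition.monotone.const_mul (smoothTransition.nonneg a))

theorem contDiff : ContDiff ℝ ∞ fun p : ℝ × ℝ => transitionAdd p.1 p.2 :=
  (contDiff_fst.add contDiff_snd).add
    ((smoothTransition.contDiff.comp contDiff_fst).mul
      (smoothTransition.contDiff.comp contDiff_snd))

theorem deriv_right_pos (a b : ℝ) : 0 < deriv (transitionAdd a) b := by
  have hs : HasDerivAt smoothTransition (deriv smoothTransition b) b :=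
    ((smoothTransition.contDiff (n := 1)).differentiable one_ne_zero b).hasDerivAt
  have hderiv : deriv (transitionAdd a) b = 1 + smoothTransition a * deriv smoothTransition b :=
    (((hasDerivAt_id b).const_add a).add (hs.const_mul _)).deriv
  rw [hderiv]
  exact add_pos_of_pos_of_nonneg one_pos
    (mul_nonneg (smoothTransition.nonneg a) smoothTransition.monotone.deriv_nonneg)

theorem bijective_right (a : ℝ) : Bijective (transitionAdd a) :=
  ⟨(strictMono_right a).injective, surjective_of_continuous_of_add_le_of_le_add
    (contDiff.continuous.comp (Continuous.prodMk_right a)) (add_le a) (le_add a)⟩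

end transitionAdd

/-- The real line with the operation `transitionAdd`: a commutative smooth loop whose translations
by nonpositive elements are the ordinary ones. -/
noncomputable def transitionLoop : AlgLoop ℝ where
  op := transitionAdd
  e := 0
  existsUnique_left a b := (transitionAdd.bijective_right a).existsUnique b
  existsUnique_right a b := by
    simpa only [transitionAdd.comm _ a] using (transitionAdd.bijective_right a).existsUnique b
  op_e := transitionAdd.zero_right
  e_op a := (transitionAdd.comm 0 a).trans (transitionAdd.zero_right a)

namespace transitionLoop

theorem isSmooth : transitionLoop.IsSmooth := by
  have hinv (a x : ℝ) : (fderiv ℝ (transitionAdd a) x).IsInvertible :=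
    isInvertible_fderiv_of_deriv_ne_zero (transitionAdd.deriv_right_pos a x).ne'
  refine AlgLoop.isSmooth_of_contDiff_op transitionAdd.contDiff hinv fun a y => ?_
  simpa only [transitionLoop, transitionAdd.comm _ a] using hinv a y

theorem not_measurePreserving_op_one : ¬ MeasurePreserving (transitionLoop.op · 1) := by
  intro h
  have hop : (transitionLoop.op · 1) = transitionAdd 1 := funext fun θ => transitionAdd.comm θ 1
  rw [hop] at h
  have hlength := sub_eq_sub_of_measurePreserving_volume (transitionAdd.strictMono_right 1) h
    zero_le_one
  norm_num [transitionAdd] at hlength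

theorem not_isInvariantRightMeasure (μ : Measure ℝ) :
    ¬ transitionLoop.IsInvariantRightMeasure μ := fun hμ =>
  not_measurePreserving_op_one <| hμ.measurePreserving_of_op_eq_add
    (fun _ hv θ => transitionAdd.of_nonpos_right θ hv) volume 1

end transitionLoop

theorem theorem3 :
    ∃ L : AlgLoop ℝ, L.IsSmooth ∧
      ¬ ∃ μ : MeasureTheory.Measure ℝ, L.IsInvariantRightMeasure μ :=
  ⟨transitionLoop, transitionLoop.isSmooth,
    fun ⟨μ, hμ⟩ => transitionLoop.not_isInvariantRightMeasure μ hμ⟩
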